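/- Let $\overline{\mathbb R}=(-\infty,\infty]$, let $\mathbb R^n$ carry the Euclidean inner product and norm, and let $\varphi:\mathbb R^n\to\overline{\mathbb R}$ be proper, lower semicontinuous and weakly convex. Here $\varphi$ is $s$-convex ($s\in\mathbb R$) if $\varphi((1-t)x+ty)\le(1-t)\varphi(x)+t\varphi(y)-\frac s2 t(1-t)\|x-y\|^2$ for all $x,y\in\mathbb R^n$, $t\in(0,1)$; it is convex if it is $0$-convex, and weakly convex if it is $s$-convex for some $s<0$. For $x$ with $\varphi(x)<\infty$, let $\partial\varphi(x)$ be the limiting subdifferential, i.e. the set of $v\in\mathbb R^n$ such that $(v,-1)$ belongs to the limiting (Mordukhovich) normal cone of $\operatorname{epi}\varphi$ at $(x,\varphi(x))$; put $\partial\varphi(x)=\emptyset$ otherwise, and $\operatorname{gph}\partial\varphi=\{(x,v): v\in\partial\varphi(x)\}$. For such $x$ and $v,w\in\mathbb R^n$, set $$\Delta^2_\tau\varphi(x,v)(u)=\frac{\varphi(x+\tau u)-\varphi(x)-\tau\langle v,u\rangle}{\frac12\tau^2},\qquad d^2\varphi(x,v)(w)=\liminf_{\tau\downarrow0,\;u\to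 w}\Delta^2_\tau\varphi(x,v)(u).$$ The function $\varphi$ is twice epi-differentiable at $x$ for $v$ if for every $w\in\mathbb R^n$ and every sequence $\tau_k\downarrow0$ there is a sequence $w^k\to w$ with $\Delta^2_{\tau_k}\varphi(x,v)(w^k)\to d^2\varphi(x,v)(w)$. It is generalized twice differentiable at $x$ for $v\in\partial\varphi(x)$ if, in addition, $d^2\varphi(x,v)$ is a generalized quadratic form, i.e. there are a symmetric matrix $A\in\mathbb R^{n\times n}$ and a linear subspace $L\subset\mathbb R^n$ such that $d^2\varphi(x,v)(w)=\langle w,Aw\rangle$ for $w\in L$ and $d^2\varphi(x,v)(w)=\infty$ for $w\notin L$. Then the following assertions are equivalent: (i) $\varphi$ is convex. (ii) For all $w\in\mathbb R^n$, $d^2\varphi(x,v)(w)\ge0$ for all $(x,v)\in\operatorname{gph}\partial\varphi$. (iii) For all $w\in\mathbb R^n$, $d^2\varphi(x,v)(w)\ge0$ for all $(x,v)\in\operatorname{gph}\partial\varphi$ such that $\varphi$ is twice epi-differentiable at $x$ for $v$. (iv) For all $w\in\mathbb R^n$, $d^2\varphi(x,v)(w)\ge0$ for all $(x,v)\in\operatorname{gph}\partial\varphi$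 such that $\varphi$ is generalized twice differentiable at $x$ for $v$. -/

import Mathlib

open Filter Topology

noncomputable section

namespace VarAnalysis

/-- Regular (Fréchet) normal cone to `Ω` at `z₀` (empty if `z₀ ∉ Ω`). The limit superior is taken
in the extended reals over points `z ≠ z₀` of `Ω` tending to `z₀`. -/
def regularNormalCone {H : Type*} [NormedAddCommGroup H] [InnerProductSpace ℝ H]
    (Ω : Set H) (z₀ : H) : Set H :=
  {v | z₀ ∈ Ω ∧
    limsup (fun z => ((inner ℝ v (z - z₀) / ‖z - z₀‖ : ℝ) : EReal)) (𝓝[Ω \ {z₀}] z₀) ≤ 0}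

/-- Limiting (Mordukhovich) normal cone to `Ω` at `z₀` (empty if `z₀ ∉ Ω`). -/
def limitingNormalCone {H : Type*} [NormedAddCommGroup H] [InnerProductSpace ℝ H]
    (Ω : Set H) (z₀ : H) : Set H :=
  {v | z₀ ∈ Ω ∧ ∃ (z : ℕ → H) (w : ℕ → H),
    (∀ k, z k ∈ Ω) ∧ Tendsto z atTop (𝓝 z₀) ∧ Tendsto w atTop (𝓝 v) ∧
      ∀ k, w k ∈ regularNormalCone Ω (z k)}

variable {n : ℕ}

/-- Proper: never `-∞` and not identically `∞`. -/
def IsProper (φ : EuclideanSpace ℝ (Fin n) → EReal) : Prop :=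
  (∀ x, φ x ≠ ⊥) ∧ ∃ x, φ x ≠ ⊤

/-- Epigraph, as a subset of `ℝⁿ × ℝ` with its Euclidean structure. -/
def epigraph (φ : EuclideanSpace ℝ (Fin n) → EReal) :
    Set (WithLp 2 (EuclideanSpace ℝ (Fin n) × ℝ)) :=
  {p | φ p.fst ≤ ((p.snd : ℝ) : EReal)}

/-- Limiting subdifferential: `v` such that `(v, -1)` is a limiting normal to the epigraph at
`(x, φ x)`. It is empty outside the effective domain. -/
def subdifferential (φ : EuclideanSpace ℝ (Fin n) → EReal) (x : EuclideanSpace ℝ (Fin n)) :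
    Set (EuclideanSpace ℝ (Fin n)) :=
  {v | φ x < ⊤ ∧
    WithLp.toLp 2 (v, (-1 : ℝ)) ∈
      limitingNormalCone (epigraph φ) (WithLp.toLp 2 (x, (φ x).toReal))}

/-- `s`-convexity on all of `ℝⁿ`. -/
def IsSConvex (s : ℝ) (φ : EuclideanSpace ℝ (Fin n) → EReal) : Prop :=
  ∀ x y : EuclideanSpace ℝ (Fin n), ∀ t : ℝ, 0 < t → t < 1 →
    φ ((1 - t) • x + t • y) ≤
      ((1 - t : ℝ) : EReal) * φ x + ((t : ℝ) : EReal) * φ y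
        - ((s / 2 * t * (1 - t) * ‖x - y‖ ^ 2 : ℝ) : EReal)

/-- Convexity: `s`-convexity with `s = 0`. -/
def IsConvex (φ : EuclideanSpace ℝ (Fin n) → EReal) : Prop := IsSConvex 0 φ

/-- Weak convexity: `s`-convexity for some `s < 0`. -/
def IsWeaklyConvex (φ : EuclideanSpace ℝ (Fin n) → EReal) : Prop := ∃ s : ℝ, s < 0 ∧ IsSConvex s φ

/-- Second-order difference quotient `Δ²_τ φ(x, v)(u)`. -/
def secondDiff (φ : EuclideanSpace ℝ (Fin n) → EReal) (x v : EuclideanSpace ℝ (Fin n))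
    (τ : ℝ) (u : EuclideanSpace ℝ (Fin n)) : EReal :=
  (φ (x + τ • u) - φ x - ((τ * inner ℝ v u : ℝ) : EReal)) / ((1 / 2 * τ ^ 2 : ℝ) : EReal)

/-- Second subderivative `d²φ(x, v)(w)`. -/
def secondSubderiv (φ : EuclideanSpace ℝ (Fin n) → EReal) (x v w : EuclideanSpace ℝ (Fin n)) :
    EReal :=
  liminf (fun p : ℝ × EuclideanSpace ℝ (Fin n) => secondDiff φ x v p.1 p.2) (𝓝[>] 0 ×ˢ 𝓝 w)

/-- Twice epi-differentiability of `φ` at `x` for `v`. -/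
def TwiceEpiDifferentiableAt (φ : EuclideanSpace ℝ (Fin n) → EReal)
    (x v : EuclideanSpace ℝ (Fin n)) : Prop :=
  ∀ (w : EuclideanSpace ℝ (Fin n)) (τ : ℕ → ℝ), (∀ k, 0 < τ k) → Tendsto τ atTop (𝓝 0) →
    ∃ u : ℕ → EuclideanSpace ℝ (Fin n), Tendsto u atTop (𝓝 w) ∧
      Tendsto (fun k => secondDiff φ x v (τ k) (u k)) atTop (𝓝 (secondSubderiv φ x v w))

/-- Quadratic form `w ↦ ⟨w, A w⟩`. -/
def quadForm (A : Matrix (Fin n) (Fin n) ℝ) (w : EuclideanSpace ℝ (Fin n)) : ℝ :=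
  inner ℝ w (Matrix.toEuclideanLin A w)

open Classical in
/-- Indicator function of a set: `0` on the set and `∞` outside. -/
def indicatorFn (L : Set (EuclideanSpace ℝ (Fin n))) (w : EuclideanSpace ℝ (Fin n)) : EReal :=
  if w ∈ L then 0 else ⊤

/-- Generalized quadratic form: a quadratic form of a symmetric matrix plus the indicator of a
linear subspace. -/
def IsGeneralizedQuadraticForm (q : EuclideanSpace ℝ (Fin n) → EReal) : Prop :=
  ∃ (A : Matrix (Fin n) (Fin n) ℝ) (L : Submodule ℝ (EuclideanSpace ℝ (Fin n))), A.IsSymm ∧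
    ∀ w, q w = (quadForm A w : EReal) + indicatorFn (L : Set (EuclideanSpace ℝ (Fin n))) w

/-- Generalized twice differentiability of `φ` at `x` for `v`. -/
def GeneralizedTwiceDifferentiableAt (φ : EuclideanSpace ℝ (Fin n) → EReal)
    (x v : EuclideanSpace ℝ (Fin n)) : Prop :=
  TwiceEpiDifferentiableAt φ x v ∧ IsGeneralizedQuadraticForm (secondSubderiv φ x v)

end VarAnalysis

end

/-! If `φ` is convex, its epigraph is convex, so every limiting normal to it supports it globally.
Each limiting subgradient is then a global one, and all second-order difference quotients are
nonnegative.

The substance is that nonnegativity at points of generalized twice differentiability forces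
convexity. For a penalty `c` with `c + s / 2 > 0`, the function `φ + c ‖· - z‖²` is strongly convex.
The proximal map `P` is therefore single-valued and Lipschitz, and the Moreau envelope `e` has the
Lipschitz gradient `2c (z - P z)`. By Rademacher, `P` has a derivative `D` at almost every `z`.
There `D` is symmetric, because `2c (I - D)` is a second derivative of `e`. Comparing difference
quotients of `e` and `φ` shows that the second subderivative of `φ` at `P z` for `2c (z - P z)`
equals `2c ⟪D w, w - D w⟫` at `D w` and `∞` off the range of `D`. This is a generalized quadratic
form, so the hypothesis applies and gives `⟪D w, w - D w⟫ ≥ 0`, hence `⟪w - D w, w⟫ ≥ 0`.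

A Lipschitz gradient with almost everywhere positive semidefinite derivative is monotone, so `e` is
convex. Since `e ≤ φ`, and `e` at a given point exceeds any number below the value of `φ` there once
`c` is large, `φ` inherits the convexity. -/

namespace VarAnalysis

/-! ### Normal cones, subgradients and the convex case -/

section Subdifferential

section NormalCone

variable {H : Type*} [NormedAddCommGroup H] [InnerProductSpace ℝ H]

theorem mem_regularNormalCone_of_inner_le {Ω : Set H} {z₀ v : H} (hz₀ : z₀ ∈ Ω) (c : ℝ)
    (h : ∀ z ∈ Ω, inner ℝ v (z - z₀) ≤ c * ‖z - z₀‖ ^ 2) : v ∈ regularNormalCone Ω z₀ := by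
  refine ⟨hz₀, ?_⟩
  -- At an isolated point of `Ω` the filter is trivial and the limsup is `⊥`.
  rcases (𝓝[Ω \ {z₀}] z₀).eq_or_neBot with hbot | hne
  · rw [hbot, limsup_bot]
    exact bot_le
  have hlim : Tendsto (fun z : H => ((c * ‖z - z₀‖ : ℝ) : EReal)) (𝓝[Ω \ {z₀}] z₀)
      (𝓝 ((0 : ℝ) : EReal)) := by
    rw [EReal.tendsto_coe]
    have : Continuous fun z : H => c * ‖z - z₀‖ := by fun_prop
    have h0 := this.tendsto z₀
    simp only [sub_self, norm_zero, mul_zero] at h0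
    exact h0.mono_left nhdsWithin_le_nhds
  have hle := limsup_le_limsup (f := 𝓝[Ω \ {z₀}] z₀)
    (u := fun z => ((inner ℝ v (z - z₀) / ‖z - z₀‖ : ℝ) : EReal))
    (v := fun z : H => ((c * ‖z - z₀‖ : ℝ) : EReal)) ?_
  · rw [hlim.limsup_eq] at hle
    simpa using hle
  · filter_upwards [self_mem_nhdsWithin] with z hz
    have hpos : 0 < ‖z - z₀‖ := norm_pos_iff.2 (sub_ne_zero.2 hz.2)
    rw [EReal.coe_le_coe_iff, div_le_iff₀ hpos]
    nlinarith [h z hz.1]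

/-- Along the segment from `z₀` to `p`, which stays in `Ω`, the normalized quotient is constant, so
its limsup bounds the value at `p`. -/
theorem inner_le_zero_of_mem_regularNormalCone {Ω : Set H} (hΩ : Convex ℝ Ω) {z₀ v p : H}
    (hv : v ∈ regularNormalCone Ω z₀) (hp : p ∈ Ω) : inner ℝ v (p - z₀) ≤ 0 := by
  obtain ⟨hz₀, hlim⟩ := hv
  by_contra! hpos
  have hne : p - z₀ ≠ 0 := by
    rintro h
    simp [h] at hpos
  have hnorm : 0 < ‖p - z₀‖ := norm_pos_iff.2 hne
  have htend : Tendsto (fun t : ℝ => z₀ + t • (p - z₀)) (𝓝[>] 0) (𝓝[Ω \ {z₀}] z₀) := by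
    rw [tendsto_nhdsWithin_iff]
    constructor
    · have : Continuous fun t : ℝ => z₀ + t • (p - z₀) := by fun_prop
      have h0 := this.tendsto 0
      simp only [zero_smul, add_zero] at h0
      exact h0.mono_left nhdsWithin_le_nhds
    · filter_upwards [Ioo_mem_nhdsGT (zero_lt_one' ℝ)] with t ht
      refine ⟨hΩ.add_smul_sub_mem hz₀ hp ⟨ht.1.le, ht.2.le⟩, ?_⟩
      simp [ht.1.ne', hne]
  have hfreq : ∃ᶠ z in 𝓝[Ω \ {z₀}] z₀, ((inner ℝ v (p - z₀) / ‖p - z₀‖ : ℝ) : EReal) ≤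
      ((inner ℝ v (z - z₀) / ‖z - z₀‖ : ℝ) : EReal) := by
    refine htend.frequently (Eventually.frequently ?_)
    filter_upwards [self_mem_nhdsWithin] with t ht
    have ht : 0 < t := ht
    rw [EReal.coe_le_coe_iff, add_sub_cancel_left, inner_smul_right, norm_smul, Real.norm_eq_abs,
      abs_of_pos ht, mul_div_mul_left _ _ ht.ne']
  have hle := (le_limsup_of_frequently_le hfreq).trans hlim
  have : inner ℝ v (p - z₀) / ‖p - z₀‖ ≤ 0 := by exact_mod_cast hle
  exact absurd this (not_le.2 (div_pos hpos hnorm))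

theorem inner_le_zero_of_mem_limitingNormalCone {Ω : Set H} (hΩ : Convex ℝ Ω) {z₀ v p : H}
    (hv : v ∈ limitingNormalCone Ω z₀) (hp : p ∈ Ω) : inner ℝ v (p - z₀) ≤ 0 := by
  obtain ⟨-, z, w, -, hz, hw, hreg⟩ := hv
  exact le_of_tendsto (hw.inner (tendsto_const_nhds.sub hz))
    (Eventually.of_forall fun k => inner_le_zero_of_mem_regularNormalCone hΩ (hreg k) hp)

theorem regularNormalCone_subset_limitingNormalCone (Ω : Set H) (z₀ : H) :
    regularNormalCone Ω z₀ ⊆ limitingNormalCone Ω z₀ := fun v hv =>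
  ⟨hv.1, fun _ => z₀, fun _ => v, fun _ => hv.1, tendsto_const_nhds, tendsto_const_nhds,
    fun _ => hv⟩

end NormalCone

variable {n : ℕ} {φ : EuclideanSpace ℝ (Fin n) → EReal} {s : ℝ}

theorem IsSConvex.toReal_le (hs : IsSConvex s φ) (hbot : ∀ x, φ x ≠ ⊥)
    {x y : EuclideanSpace ℝ (Fin n)} (hx : φ x ≠ ⊤) (hy : φ y ≠ ⊤) {t : ℝ} (h0 : 0 < t)
    (h1 : t < 1) :
    φ ((1 - t) • x + t • y) ≠ ⊤ ∧ (φ ((1 - t) • x + t • y)).toReal ≤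
      (1 - t) * (φ x).toReal + t * (φ y).toReal - s / 2 * t * (1 - t) * ‖x - y‖ ^ 2 := by
  have h := hs x y t h0 h1
  rw [← EReal.coe_toReal hx (hbot x), ← EReal.coe_toReal hy (hbot y), ← EReal.coe_mul,
    ← EReal.coe_mul, ← EReal.coe_add, ← EReal.coe_sub] at h
  have hne : φ ((1 - t) • x + t • y) ≠ ⊤ := ne_top_of_le_ne_top (EReal.coe_ne_top _) h
  refine ⟨hne, ?_⟩
  rwa [← EReal.coe_toReal hne (hbot _), EReal.coe_le_coe_iff] at h

theorem IsConvex.convex_epigraph (hc : IsConvex φ) : Convex ℝ (epigraph φ) := by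
  rw [convex_iff_forall_pos]
  intro p hp q hq a b ha hb hab
  obtain rfl : a = 1 - b := by linarith
  have h := hc p.fst q.fst b hb (by linarith)
  have hp : φ p.fst ≤ (p.snd : EReal) := hp
  have hq : φ q.fst ≤ (q.snd : EReal) := hq
  change φ ((1 - b) • p.fst + b • q.fst) ≤ (((1 - b) * p.snd + b * q.snd : ℝ) : EReal)
  refine h.trans ?_
  have hzero : (0 / 2 * b * (1 - b) * ‖p.fst - q.fst‖ ^ 2 : ℝ) = 0 := by ring
  rw [hzero, EReal.coe_zero, sub_zero, EReal.coe_add, EReal.coe_mul, EReal.coe_mul]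
  exact add_le_add (mul_le_mul_of_nonneg_left hp (by exact_mod_cast ha.le))
    (mul_le_mul_of_nonneg_left hq (by exact_mod_cast hb.le))

theorem inner_toLp_neg_one (v x y : EuclideanSpace ℝ (Fin n)) (a b : ℝ) :
    inner ℝ (WithLp.toLp 2 (v, (-1 : ℝ))) (WithLp.toLp 2 (y, b) - WithLp.toLp 2 (x, a)) =
      inner ℝ v (y - x) - (b - a) := by
  simp [WithLp.prod_inner_apply]
  ring

theorem IsConvex.inner_le_of_mem_subdifferential (hc : IsConvex φ) (hbot : ∀ x, φ x ≠ ⊥)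
    {x v y : EuclideanSpace ℝ (Fin n)} (hv : v ∈ subdifferential φ x) (hy : φ y ≠ ⊤) :
    inner ℝ v (y - x) ≤ (φ y).toReal - (φ x).toReal := by
  have h := inner_le_zero_of_mem_limitingNormalCone hc.convex_epigraph hv.2
    (p := WithLp.toLp 2 (y, (φ y).toReal))
    (EReal.coe_toReal hy (hbot y)).ge
  rw [inner_toLp_neg_one] at h
  linarith

/-- A proximal subgradient is a limiting one: the quadratic error in `y - x` is dominated by the
squared distance between epigraph points. -/
theorem mem_subdifferential_of_forall_toReal_ge {x v : EuclideanSpace ℝ (Fin n)}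
    (hbot : ∀ x, φ x ≠ ⊥) (hx : φ x ≠ ⊤) {c : ℝ} (hc : 0 ≤ c)
    (h : ∀ y, φ y ≠ ⊤ →
      (φ x).toReal + inner ℝ v (y - x) - c * ‖y - x‖ ^ 2 ≤ (φ y).toReal) :
    v ∈ subdifferential φ x := by
  refine ⟨hx.lt_top, regularNormalCone_subset_limitingNormalCone _ _
    (mem_regularNormalCone_of_inner_le (EReal.coe_toReal hx (hbot x)).ge c ?_)⟩
  intro z hz
  have hz' : φ z.fst ≤ (z.snd : EReal) := hz
  have hfin : φ z.fst ≠ ⊤ := ne_top_of_le_ne_top (EReal.coe_ne_top _) hz'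
  rw [← EReal.coe_toReal hfin (hbot _), EReal.coe_le_coe_iff] at hz'
  have hin := inner_toLp_neg_one v x z.fst (φ x).toReal z.snd
  have hnorm : ‖z.fst - x‖ ^ 2 ≤ ‖z - WithLp.toLp 2 (x, (φ x).toReal)‖ ^ 2 := by
    rw [WithLp.prod_norm_sq_eq_of_L2]
    simp
    positivity
  have hzz : WithLp.toLp 2 (z.fst, z.snd) = z := rfl
  rw [hzz] at hin
  rw [hin]
  nlinarith [h z.fst hfin, mul_le_mul_of_nonneg_left hnorm hc]

theorem secondDiff_eq_coe (hbot : ∀ x, φ x ≠ ⊥) {x u : EuclideanSpace ℝ (Fin n)} {τ : ℝ}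
    (v : EuclideanSpace ℝ (Fin n)) (hx : φ x ≠ ⊤) (hu : φ (x + τ • u) ≠ ⊤) :
    secondDiff φ x v τ u = ((((φ (x + τ • u)).toReal - (φ x).toReal - τ * inner ℝ v u) /
      (1 / 2 * τ ^ 2) : ℝ) : EReal) := by
  rw [secondDiff, EReal.coe_div, EReal.coe_sub, EReal.coe_sub, EReal.coe_toReal hx (hbot x),
    EReal.coe_toReal hu (hbot _)]

theorem secondDiff_eq_top (hbot : ∀ x, φ x ≠ ⊥) {x u : EuclideanSpace ℝ (Fin n)} {τ : ℝ}
    (v : EuclideanSpace ℝ (Fin n)) (hx : φ x ≠ ⊤) (hτ : 0 < τ) (hu : φ (x + τ • u) = ⊤) :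
    secondDiff φ x v τ u = ⊤ := by
  rw [secondDiff, hu, ← EReal.coe_toReal hx (hbot x), EReal.top_sub_coe, EReal.top_sub_coe]
  exact EReal.top_div_of_pos_ne_top (by exact_mod_cast (by positivity)) (EReal.coe_ne_top _)

/-- A real lower bound for the numerator bounds the second-order difference quotient. -/
theorem coe_le_secondDiff (hbot : ∀ x, φ x ≠ ⊥) {x v u : EuclideanSpace ℝ (Fin n)} {τ b : ℝ}
    (hx : φ x ≠ ⊤) (hτ : 0 < τ)
    (h : φ (x + τ • u) ≠ ⊤ → b * (1 / 2 * τ ^ 2) ≤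
      (φ (x + τ • u)).toReal - (φ x).toReal - τ * inner ℝ v u) :
    (b : EReal) ≤ secondDiff φ x v τ u := by
  by_cases hu : φ (x + τ • u) = ⊤
  · rw [secondDiff_eq_top hbot v hx hτ hu]
    exact le_top
  · rw [secondDiff_eq_coe hbot v hx hu, EReal.coe_le_coe_iff, le_div_iff₀ (by positivity)]
    exact h hu

theorem IsConvex.secondSubderiv_nonneg (hc : IsConvex φ) (hbot : ∀ x, φ x ≠ ⊥)
    {x v : EuclideanSpace ℝ (Fin n)} (hv : v ∈ subdifferential φ x)
    (w : EuclideanSpace ℝ (Fin n)) : 0 ≤ secondSubderiv φ x v w := by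
  refine le_liminf_of_le (by isBoundedDefault) ?_
  have hτ : ∀ᶠ p : ℝ × EuclideanSpace ℝ (Fin n) in 𝓝[>] 0 ×ˢ 𝓝 w, 0 < p.1 :=
    tendsto_fst.eventually self_mem_nhdsWithin
  filter_upwards [hτ] with p hp
  refine coe_le_secondDiff (b := 0) hbot hv.1.ne hp fun hu => ?_
  have h := hc.inner_le_of_mem_subdifferential hbot hv hu
  rw [add_sub_cancel_left, inner_smul_right] at h
  linarith

end Subdifferential

/-! ### Quadratic minorants and existence of proximal points -/

section MoreauEnvelope

variable {n : ℕ} {φ : EuclideanSpace ℝ (Fin n) → EReal} {s : ℝ}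

theorem exists_real_le_on_closedBall (hbot : ∀ x, φ x ≠ ⊥) (hlsc : LowerSemicontinuous φ)
    (x : EuclideanSpace ℝ (Fin n)) (r : ℝ) :
    ∃ m : ℝ, ∀ y ∈ Metric.closedBall x r, (m : EReal) ≤ φ y := by
  rcases (Metric.closedBall x r).eq_empty_or_nonempty with h | h
  · exact ⟨0, by simp [h]⟩
  obtain ⟨p, -, hmin⟩ := (hlsc.lowerSemicontinuousOn _).exists_isMinOn h
    (isCompact_closedBall x r)
  obtain ⟨m, -, hm⟩ := EReal.lt_iff_exists_real_btwn.1 (bot_lt_iff_ne_bot.2 (hbot p))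
  exact ⟨m, fun y hy => hm.le.trans (hmin hy)⟩

/-- A weakly convex function is bounded below by a quadratic with the expected leading term. -/
theorem IsSConvex.exists_quadratic_minorant (hs : IsSConvex s φ) (hs0 : s ≤ 0)
    (hbot : ∀ x, φ x ≠ ⊥) (hlsc : LowerSemicontinuous φ) {x₀ : EuclideanSpace ℝ (Fin n)}
    (hx₀ : φ x₀ ≠ ⊤) :
    ∃ C : ℝ, 0 ≤ C ∧ ∀ y, φ y ≠ ⊤ →
      -C * (1 + ‖y - x₀‖) + s / 2 * ‖y - x₀‖ ^ 2 ≤ (φ y).toReal := by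
  obtain ⟨m, hm⟩ := exists_real_le_on_closedBall hbot hlsc x₀ 1
  have hm' : ∀ y, φ y ≠ ⊤ → ‖y - x₀‖ ≤ 1 → m ≤ (φ y).toReal := by
    intro y hy hd
    have := hm y (by rwa [mem_closedBall_iff_norm])
    rwa [← EReal.coe_toReal hy (hbot y), EReal.coe_le_coe_iff] at this
  refine ⟨|m| + |(φ x₀).toReal|, by positivity, fun y hy => ?_⟩
  set r := ‖y - x₀‖ with hr
  set f₀ := (φ x₀).toReal
  have hr0 : 0 ≤ r := norm_nonneg _
  rcases le_or_gt r 1 with h1 | h1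
  · have := hm' y hy h1
    nlinarith [neg_abs_le m, abs_nonneg m, abs_nonneg f₀, sq_nonneg r,
      mul_nonneg (add_nonneg (abs_nonneg m) (abs_nonneg f₀)) hr0]
  · have hrpos : 0 < r := by linarith
    -- With `t = 1 / r` the combination lies on the unit sphere about `x₀`, where `φ ≥ m`;
    -- multiplying by `r` then isolates `φ y`.
    obtain ⟨hfin, hle⟩ := hs.toReal_le hbot hx₀ hy (t := 1 / r) (by positivity)
      (by rw [div_lt_one hrpos]; exact h1)
    have hball := hm' _ hfin (by
      have : (1 - 1 / r) • x₀ + (1 / r) • y - x₀ = (1 / r) • (y - x₀) := by module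
      rw [this, norm_smul, ← hr, Real.norm_of_nonneg (by positivity)]
      field_simp; rfl)
    rw [norm_sub_rev, ← hr] at hle
    have h2 := mul_le_mul_of_nonneg_left (hball.trans hle) hr0
    have h3 : r * ((1 - 1 / r) * f₀ + 1 / r * (φ y).toReal -
        s / 2 * (1 / r) * (1 - 1 / r) * r ^ 2) =
        (r - 1) * f₀ + (φ y).toReal - s / 2 * (r - 1) * r := by
      field_simp
    rw [h3] at h2
    nlinarith [neg_abs_le m, abs_nonneg m, abs_nonneg f₀, le_abs_self f₀,
      mul_nonneg hr0 (sub_nonneg.2 (neg_abs_le m)),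
      mul_nonneg (sub_nonneg.2 h1.le) (sub_nonneg.2 (le_abs_self f₀)),
      mul_nonneg (neg_nonneg.2 hs0) hr0]

/-- `p` is the proximal point of `φ` at `z` with penalty `c ‖· - z‖²`, with quadratic growth
`κ ‖· - p‖²` of the penalized function. -/
def IsProxPoint (φ : EuclideanSpace ℝ (Fin n) → EReal) (c κ : ℝ)
    (z p : EuclideanSpace ℝ (Fin n)) : Prop :=
  φ p ≠ ⊤ ∧ ∀ y, φ y ≠ ⊤ →
    (φ p).toReal + c * ‖p - z‖ ^ 2 + κ * ‖y - p‖ ^ 2 ≤ (φ y).toReal + c * ‖y - z‖ ^ 2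

theorem exists_penalized_minimizer (hs : IsSConvex s φ) (hs0 : s ≤ 0)
    (hproper : IsProper φ) (hlsc : LowerSemicontinuous φ) {c : ℝ} (hc : 0 < c + s / 2)
    (z : EuclideanSpace ℝ (Fin n)) :
    ∃ p, φ p ≠ ⊤ ∧ ∀ y, φ y ≠ ⊤ →
      (φ p).toReal + c * ‖p - z‖ ^ 2 ≤ (φ y).toReal + c * ‖y - z‖ ^ 2 := by
  obtain ⟨hbot, x₀, hx₀⟩ := hproper
  obtain ⟨C, hC, hmin⟩ := hs.exists_quadratic_minorant hs0 hbot hlsc hx₀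
  set F : EuclideanSpace ℝ (Fin n) → EReal := fun y => φ y + ((c * ‖y - z‖ ^ 2 : ℝ) : EReal)
    with hF
  have hFlsc : LowerSemicontinuous F := by
    refine hlsc.add' (Continuous.lowerSemicontinuous ?_) fun x => ?_
    · exact continuous_coe_real_ereal.comp (by fun_prop)
    · exact EReal.continuousAt_add (Or.inr (EReal.coe_ne_bot _)) (Or.inr (EReal.coe_ne_top _))
  have hFcoe : ∀ y, φ y ≠ ⊤ → F y = (((φ y).toReal + c * ‖y - z‖ ^ 2 : ℝ) : EReal) := by
    intro y hy
    rw [hF, EReal.coe_add, EReal.coe_toReal hy (hbot y)]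
  set κ := c + s / 2 with hκ
  set a := ‖x₀ - z‖ with ha
  set B := (φ x₀).toReal + c * ‖x₀ - z‖ ^ 2 with hB
  have ha0 : 0 ≤ a := norm_nonneg _
  have hc0 : 0 < c := by linarith
  -- Beyond this radius the minorant plus the penalty, whose leading coefficient is `κ > 0`, exceeds
  -- the value `B` at `x₀`. The `+ 1` guarantees `R ≥ 1`.
  set R := (C + 2 * c * a + |B| + C) / κ + 1 with hR
  have hR1 : 1 ≤ R := by
    have : 0 ≤ (C + 2 * c * a + |B| + C) / κ := by positivity
    linarith
  obtain ⟨p, hp, hpmin⟩ := (hFlsc.lowerSemicontinuousOn _).exists_isMinOn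
    (Metric.nonempty_closedBall.2 (zero_le_one.trans hR1)) (isCompact_closedBall x₀ R)
  have hpx₀ : F p ≤ F x₀ := hpmin (Metric.mem_closedBall_self (zero_le_one.trans hR1))
  have hpfin : φ p ≠ ⊤ := by
    intro h
    rw [hFcoe x₀ hx₀, hF] at hpx₀
    simp only [h, EReal.top_add_coe, top_le_iff] at hpx₀
    exact EReal.coe_ne_top _ hpx₀
  refine ⟨p, hpfin, fun y hy => ?_⟩
  rw [hFcoe p hpfin, hFcoe x₀ hx₀, EReal.coe_le_coe_iff] at hpx₀
  by_cases hyR : ‖y - x₀‖ ≤ R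
  · have := hpmin (mem_closedBall_iff_norm.2 hyR)
    simp only [Set.mem_ofPred_eq] at this
    rwa [hFcoe p hpfin, hFcoe y hy, EReal.coe_le_coe_iff] at this
  · refine hpx₀.trans ?_
    have h1 := hmin y hy
    have h2 : (‖y - x₀‖ - a) ^ 2 ≤ ‖y - z‖ ^ 2 := by
      have h3 : |‖y - x₀‖ - ‖z - x₀‖| ≤ ‖(y - x₀) - (z - x₀)‖ := abs_norm_sub_norm_le _ _
      rw [sub_sub_sub_cancel_right, norm_sub_rev z] at h3
      exact sq_le_sq' (by linarith [neg_abs_le (‖y - x₀‖ - a)]) ((le_abs_self _).trans h3)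
    set r := ‖y - x₀‖
    have hr : R < r := not_le.1 hyR
    have h4 : C + 2 * c * a + |B| + C ≤ κ * r := by
      have : (C + 2 * c * a + |B| + C) / κ ≤ r := by linarith
      rwa [div_le_iff₀' hc] at this
    have h5 : |B| + C ≤ r * (κ * r - (C + 2 * c * a)) := by
      nlinarith [abs_nonneg B]
    have h6 := mul_le_mul_of_nonneg_left h2 hc0.le
    have h7 : 0 ≤ c * a ^ 2 := by positivity
    have h8 : r * (κ * r - (C + 2 * c * a)) - C + c * a ^ 2 =
      -C * (1 + r) + s / 2 * r ^ 2 + c * (r - a) ^ 2 := by rw [hκ]; ring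
    linarith [le_abs_self B]

theorem norm_sq_convex_comb (t : ℝ) (x y : EuclideanSpace ℝ (Fin n)) :
    ‖(1 - t) • x + t • y‖ ^ 2 = (1 - t) * ‖x‖ ^ 2 + t * ‖y‖ ^ 2 - t * (1 - t) * ‖x - y‖ ^ 2 := by
  rw [norm_add_sq_real, norm_sub_sq_real, norm_smul, norm_smul, inner_smul_left, inner_smul_right,
    mul_pow, mul_pow, Real.norm_eq_abs, Real.norm_eq_abs, sq_abs, sq_abs]
  simp only [conj_trivial]
  ring

/-- Comparing the minimizer `p` with `(1 - t) p + t y`, dividing by `t` and letting `t ↓ 0` gives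
the quadratic growth with constant `c + s / 2`. -/
theorem exists_isProxPoint (hs : IsSConvex s φ) (hs0 : s ≤ 0)
    (hproper : IsProper φ) (hlsc : LowerSemicontinuous φ) {c : ℝ} (hc : 0 < c + s / 2)
    (z : EuclideanSpace ℝ (Fin n)) : ∃ p, IsProxPoint φ c (c + s / 2) z p := by
  obtain ⟨p, hp, hmin⟩ := exists_penalized_minimizer hs hs0 hproper hlsc hc z
  refine ⟨p, hp, fun y hy => ?_⟩
  have key : ∀ t : ℝ, 0 < t → t < 1 → (φ p).toReal + c * ‖p - z‖ ^ 2 +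
      (1 - t) * ((c + s / 2) * ‖y - p‖ ^ 2) ≤ (φ y).toReal + c * ‖y - z‖ ^ 2 := by
    intro t h0 h1
    obtain ⟨hfin, hle⟩ := hs.toReal_le hproper.1 hp hy h0 h1
    have h2 := hmin _ hfin
    have h3 : (1 - t) • p + t • y - z = (1 - t) • (p - z) + t • (y - z) := by module
    rw [h3, norm_sq_convex_comb, sub_sub_sub_cancel_right, norm_sub_rev p y] at h2
    rw [norm_sub_rev p y] at hle
    refine le_of_mul_le_mul_left ?_ h0
    linarith
  have hcont : Continuous fun t : ℝ => (φ p).toReal + c * ‖p - z‖ ^ 2 +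
      (1 - t) * ((c + s / 2) * ‖y - p‖ ^ 2) := by fun_prop
  have hlim := (hcont.tendsto 0).mono_left (nhdsWithin_le_nhds (s := Set.Ioi 0))
  simp only [sub_zero, one_mul] at hlim
  refine le_of_tendsto hlim ?_
  filter_upwards [Ioo_mem_nhdsGT (zero_lt_one' ℝ)] with t ht
  exact key t ht.1 ht.2

/-- For large penalties the penalized function stays above any value below `φ m`. -/
theorem IsSConvex.exists_penalty_le (hs : IsSConvex s φ) (hs0 : s ≤ 0)
    (hproper : IsProper φ) (hlsc : LowerSemicontinuous φ) {m : EuclideanSpace ℝ (Fin n)} {b : ℝ}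
    (hb : (b : EReal) < φ m) :
    ∃ c₀ : ℝ, ∀ c, c₀ ≤ c → ∀ y, φ y ≠ ⊤ → b ≤ (φ y).toReal + c * ‖y - m‖ ^ 2 := by
  obtain ⟨hbot, x₀, hx₀⟩ := hproper
  obtain ⟨C, hC, hmin⟩ := hs.exists_quadratic_minorant hs0 hbot hlsc hx₀
  obtain ⟨δ, hδ, hball⟩ := Metric.eventually_nhds_iff.1 (hlsc m b hb)
  set a := ‖m - x₀‖ with ha
  have ha0 : 0 ≤ a := norm_nonneg _
  set A := C * (2 + a) - s * a ^ 2 with hA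
  have hA0 : 0 ≤ A := by
    have : 0 ≤ -s * a ^ 2 := mul_nonneg (by linarith) (sq_nonneg a)
    have : 0 ≤ C * (2 + a) := by positivity
    linarith
  -- Within `δ` of `m` semicontinuity suffices. Farther away the minorant is at least `-A - (C - s)
  -- d²`; the remaining penalty is at least `A + |b|` because `d ≥ δ`.
  refine ⟨C - s + (A + |b|) / δ ^ 2, fun c hc y hy => ?_⟩
  have hquot : 0 ≤ (A + |b|) / δ ^ 2 := by positivity
  set d := ‖y - m‖ with hd
  have hd0 : 0 ≤ d := norm_nonneg _
  by_cases hdδ : d < δ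
  · have h1 := hball (y := y) (by rwa [dist_eq_norm])
    change (b : EReal) < φ y at h1
    rw [← EReal.coe_toReal hy (hbot y), EReal.coe_lt_coe_iff] at h1
    have : 0 ≤ c * d ^ 2 := mul_nonneg (by linarith) (sq_nonneg d)
    linarith
  · have h1 := hmin y hy
    have hr : ‖y - x₀‖ ≤ d + a := by
      have := norm_add_le (y - m) (m - x₀)
      rwa [sub_add_sub_cancel] at this
    set r := ‖y - x₀‖
    have hr0 : 0 ≤ r := norm_nonneg _
    have h2 : r ^ 2 ≤ 2 * (d ^ 2 + a ^ 2) := by nlinarith [sq_nonneg (d - a)]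
    have h3 : -s * r ^ 2 ≤ -s * (2 * (d ^ 2 + a ^ 2)) :=
      mul_le_mul_of_nonneg_left h2 (by linarith)
    have h4 : C * (1 + r) ≤ C * (2 + a + d ^ 2) := by
      refine mul_le_mul_of_nonneg_left ?_ hC
      nlinarith [sq_nonneg (d - 1)]
    have h5 : δ ^ 2 ≤ d ^ 2 := by
      have := not_lt.1 hdδ
      gcongr
    have h6 : A + |b| ≤ (c - (C - s)) * d ^ 2 := by
      calc A + |b| = (A + |b|) / δ ^ 2 * δ ^ 2 := by field_simp
        _ ≤ (c - (C - s)) * d ^ 2 := by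
          refine mul_le_mul (by linarith) h5 (sq_nonneg _) (by linarith)
    nlinarith [le_abs_self b]

/-! ### Lipschitz proximal map and differentiability of the envelope -/

section ProxMap

variable {c κ : ℝ} {P : EuclideanSpace ℝ (Fin n) → EuclideanSpace ℝ (Fin n)}

/-- Adding the two growth inequalities, each tested at the other proximal point, leaves `κ ‖P z - P
z'‖² ≤ c ⟪P z - P z', z - z'⟫`; then Cauchy–Schwarz. -/
theorem mul_norm_prox_sub_le (hP : ∀ z, IsProxPoint φ c κ z (P z)) (hc : 0 ≤ c)
    (z z' : EuclideanSpace ℝ (Fin n)) : κ * ‖P z - P z'‖ ≤ c * ‖z - z'‖ := by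
  have h1 := (hP z).2 _ (hP z').1
  have h2 := (hP z').2 _ (hP z).1
  have h3 : ‖P z' - z‖ ^ 2 - ‖P z - z‖ ^ 2 + ‖P z - z'‖ ^ 2 - ‖P z' - z'‖ ^ 2 =
      2 * inner ℝ (P z - P z') (z - z') := by
    simp only [norm_sub_sq_real, inner_sub_left, inner_sub_right]
    ring
  have h4 := real_inner_le_norm (P z - P z') (z - z')
  rw [norm_sub_rev (P z') (P z)] at h1
  have h6 : c * (‖P z' - z‖ ^ 2 - ‖P z - z‖ ^ 2 + ‖P z - z'‖ ^ 2 - ‖P z' - z'‖ ^ 2) ≤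
      c * (2 * (‖P z - P z'‖ * ‖z - z'‖)) := by
    rw [h3]
    gcongr
  rcases (norm_nonneg (P z - P z')).eq_or_lt with h0 | hpos
  · rw [← h0, mul_zero]
    positivity
  · refine le_of_mul_le_mul_left ?_ hpos
    nlinarith

theorem lipschitzWith_prox (hP : ∀ z, IsProxPoint φ c κ z (P z)) (hc : 0 ≤ c) (hκ : 0 < κ) :
    LipschitzWith (c / κ).toNNReal P := by
  refine LipschitzWith.of_dist_le_mul fun z z' => ?_
  rw [dist_eq_norm, dist_eq_norm, Real.coe_toNNReal _ (by positivity), div_mul_eq_mul_div,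
    le_div_iff₀' hκ]
  exact mul_norm_prox_sub_le hP hc z z'

/-- The Moreau envelope attached to a proximal map. -/
noncomputable def envelope (φ : EuclideanSpace ℝ (Fin n) → EReal) (c : ℝ)
    (P : EuclideanSpace ℝ (Fin n) → EuclideanSpace ℝ (Fin n))
    (z : EuclideanSpace ℝ (Fin n)) : ℝ :=
  (φ (P z)).toReal + c * ‖P z - z‖ ^ 2

theorem envelope_le (hP : ∀ z, IsProxPoint φ c κ z (P z)) (hκ : 0 ≤ κ)
    (z : EuclideanSpace ℝ (Fin n)) {y : EuclideanSpace ℝ (Fin n)} (hy : φ y ≠ ⊤) :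
    envelope φ c P z ≤ (φ y).toReal + c * ‖y - z‖ ^ 2 := by
  have := (hP z).2 y hy
  have h2 : 0 ≤ κ * ‖y - P z‖ ^ 2 := by positivity
  rw [envelope]
  linarith

theorem prox_mem_subdifferential (hP : ∀ z, IsProxPoint φ c κ z (P z)) (hbot : ∀ x, φ x ≠ ⊥)
    (hc : 0 ≤ c) (hκ : 0 ≤ κ) (z : EuclideanSpace ℝ (Fin n)) :
    (2 * c) • (z - P z) ∈ subdifferential φ (P z) := by
  refine mem_subdifferential_of_forall_toReal_ge hbot (hP z).1 hc fun y hy => ?_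
  have h1 := envelope_le hP hκ z hy
  have h2 : ‖y - z‖ ^ 2 = ‖y - P z‖ ^ 2 - 2 * inner ℝ (z - P z) (y - P z) + ‖P z - z‖ ^ 2 := by
    have : y - z = (y - P z) - (z - P z) := by abel
    rw [this, norm_sub_sq_real, norm_sub_rev (P z) z, real_inner_comm]
  rw [envelope, h2] at h1
  rw [inner_smul_left]
  simp only [conj_trivial]
  linarith

/-- `P z` is a competitor in the minimization defining the envelope at `z'`. -/
theorem envelope_sub_le (hP : ∀ z, IsProxPoint φ c κ z (P z)) (hκ : 0 ≤ κ)
    (z z' : EuclideanSpace ℝ (Fin n)) :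
    envelope φ c P z' ≤ envelope φ c P z + inner ℝ ((2 * c) • (z - P z)) (z' - z) +
      c * ‖z' - z‖ ^ 2 := by
  have h1 := envelope_le hP hκ z' (hP z).1
  have h2 : ‖P z - z'‖ ^ 2 = ‖P z - z‖ ^ 2 + 2 * inner ℝ (z - P z) (z' - z) + ‖z' - z‖ ^ 2 := by
    have : P z - z' = -((z - P z) + (z' - z)) := by abel
    rw [this, norm_neg, norm_add_sq_real, norm_sub_rev z (P z)]
  rw [h2] at h1
  simp only [envelope, inner_smul_left] at *
  simp only [conj_trivial]
  linarith

/-- The upper estimate bounds the remainder from above; with `z` and `z'` exchanged it bounds it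
from below, the change of gradient being controlled by the Lipschitz bound on `P`. The remainder is
thus quadratic. -/
theorem hasFDerivAt_envelope (hP : ∀ z, IsProxPoint φ c κ z (P z)) (hc : 0 ≤ c) (hκ : 0 < κ)
    (z : EuclideanSpace ℝ (Fin n)) :
    HasFDerivAt (envelope φ c P) (innerSL ℝ ((2 * c) • (z - P z))) z := by
  refine HasFDerivAt.of_isLittleO ?_
  have hbig : (fun z' => envelope φ c P z' - envelope φ c P z -
      innerSL ℝ ((2 * c) • (z - P z)) (z' - z)) =O[𝓝 z] fun z' => ‖z' - z‖ ^ 2 := by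
    refine Asymptotics.IsBigO.of_bound (c + 2 * c * (1 + c / κ)) (Eventually.of_forall fun z' => ?_)
    have h1 := envelope_sub_le hP hκ.le z z'
    have h2 := envelope_sub_le hP hκ.le z' z
    have h3 : ‖P z' - P z‖ ≤ c / κ * ‖z' - z‖ := by
      rw [div_mul_eq_mul_div, le_div_iff₀' hκ]
      exact mul_norm_prox_sub_le hP hc z' z
    have h4 : inner ℝ ((2 * c) • (z' - P z')) (z - z') =
        -inner ℝ ((2 * c) • (z - P z)) (z' - z) -
          2 * c * inner ℝ ((z' - z) - (P z' - P z)) (z' - z) := by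
      simp only [inner_smul_left, inner_sub_left, inner_sub_right, conj_trivial]
      ring
    have h5 : -inner ℝ ((z' - z) - (P z' - P z)) (z' - z) ≤ (1 + c / κ) * ‖z' - z‖ ^ 2 := by
      refine (neg_le_abs _).trans ((abs_real_inner_le_norm _ _).trans ?_)
      have := norm_sub_le (z' - z) (P z' - P z)
      have h6 : ‖z' - z - (P z' - P z)‖ ≤ (1 + c / κ) * ‖z' - z‖ := by linarith
      calc _ ≤ (1 + c / κ) * ‖z' - z‖ * ‖z' - z‖ := by gcongr
        _ = _ := by ring
    have h6 := mul_le_mul_of_nonneg_left h5 (by positivity : 0 ≤ 2 * c)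
    rw [norm_sub_rev z z'] at h2
    rw [h4] at h2
    have h7 : 0 ≤ 2 * c * ((1 + c / κ) * ‖z' - z‖ ^ 2) := by positivity
    have h8 : 0 ≤ c * ‖z' - z‖ ^ 2 := by positivity
    rw [innerSL_apply_apply, Real.norm_eq_abs, norm_pow, norm_norm, abs_le]
    constructor <;> linarith
  refine hbig.trans_isLittleO ?_
  exact (Asymptotics.isLittleO_pow_sub_sub z one_lt_two)

end ProxMap

end MoreauEnvelope

/-! ### Second subderivatives where the proximal map is differentiable -/

section SecondOrder

variable {n : ℕ} {φ : EuclideanSpace ℝ (Fin n) → EReal} {c κ : ℝ}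
  {P : EuclideanSpace ℝ (Fin n) → EuclideanSpace ℝ (Fin n)}
  {D : EuclideanSpace ℝ (Fin n) →L[ℝ] EuclideanSpace ℝ (Fin n)}
  {z : EuclideanSpace ℝ (Fin n)}

/-- Symmetry of second derivatives needs the gradient `2c (z - P z)` to be differentiable only at
the one point `z`. -/
theorem inner_fderiv_prox_comm (hP : ∀ z, IsProxPoint φ c κ z (P z)) (hc : 0 < c) (hκ : 0 < κ)
    (hD : HasFDerivAt P D z) (a b : EuclideanSpace ℝ (Fin n)) :
    inner ℝ (D a) b = inner ℝ a (D b) := by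
  let B : EuclideanSpace ℝ (Fin n) →L[ℝ] EuclideanSpace ℝ (Fin n) →L[ℝ] ℝ :=
    (isBoundedBilinearMap_inner (𝕜 := ℝ) (E := EuclideanSpace ℝ (Fin n))).toContinuousLinearMap
  have hf : ∀ y, HasFDerivAt (envelope φ c P) (B ((2 * c) • (y - P y))) y := by
    intro y
    exact hasFDerivAt_envelope hP hc.le hκ y
  have hin : HasFDerivAt (fun y => (2 * c) • (y - P y))
      ((2 * c) • (ContinuousLinearMap.id ℝ (EuclideanSpace ℝ (Fin n)) - D)) z :=
    ((hasFDerivAt_id z).sub hD).const_smul (2 * c)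
  have h := second_derivative_symmetric hf (B.hasFDerivAt.comp z hin) a b
  have hB : ∀ p q, B p q = inner ℝ p q := fun _ _ => rfl
  simp only [ContinuousLinearMap.comp_apply, smul_apply,
    sub_apply, ContinuousLinearMap.id_apply, hB, inner_smul_left,
    inner_sub_left, conj_trivial] at h
  have h2 := mul_left_cancel₀ (by positivity : 2 * c ≠ 0) h
  rw [real_inner_comm (D b) a]
  rw [real_inner_comm a b] at h2
  linarith

theorem tendsto_prox_slope (hD : HasFDerivAt P D z) (w : EuclideanSpace ℝ (Fin n)) :
    Tendsto (fun τ : ℝ => τ⁻¹ • (P (z + τ • w) - P z)) (𝓝[>] 0) (𝓝 (D w)) := by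
  have h := (hD.hasLineDerivAt w).tendsto_slope_zero_right
  simpa using h

/-- L'Hôpital reduces the second-order quotient to the slope of the gradient at `z`. -/
theorem tendsto_envelope_secondDiff (hP : ∀ z, IsProxPoint φ c κ z (P z)) (hc : 0 < c)
    (hκ : 0 < κ) (hD : HasFDerivAt P D z) (w : EuclideanSpace ℝ (Fin n)) :
    Tendsto (fun τ : ℝ => (envelope φ c P (z + τ • w) - envelope φ c P z -
      τ * inner ℝ ((2 * c) • (z - P z)) w) / (1 / 2 * τ ^ 2)) (𝓝[>] 0)
      (𝓝 (2 * c * inner ℝ w (w - D w))) := by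
  have hline : ∀ τ : ℝ, HasDerivAt (fun τ : ℝ => z + τ • w) w τ := fun τ => by
    simpa using ((hasDerivAt_id τ).smul_const w).const_add z
  have hderiv : ∀ τ : ℝ, HasDerivAt (fun τ : ℝ => envelope φ c P (z + τ • w) - envelope φ c P z -
      τ * inner ℝ ((2 * c) • (z - P z)) w)
      (inner ℝ ((2 * c) • (z + τ • w - P (z + τ • w))) w -
        inner ℝ ((2 * c) • (z - P z)) w) τ := by
    intro τ
    have h1 := (hasFDerivAt_envelope hP hc.le hκ (z + τ • w)).comp_hasDerivAt τ (hline τ)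
    have h2 := (hasDerivAt_id τ).mul_const (inner ℝ ((2 * c) • (z - P z)) w)
    rw [one_mul] at h2
    exact (h1.sub_const _).sub h2
  refine HasDerivAt.lhopital_zero_nhdsGT (f' := fun τ : ℝ =>
    inner ℝ ((2 * c) • (z + τ • w - P (z + τ • w))) w - inner ℝ ((2 * c) • (z - P z)) w)
    (g' := fun τ => τ) (Eventually.of_forall hderiv) (Eventually.of_forall fun τ => ?_) ?_ ?_ ?_ ?_
  · have := ((hasDerivAt_id τ).pow 2).const_mul (1 / 2 : ℝ)
    simpa using this
  · filter_upwards [self_mem_nhdsWithin] with τ hτ using ne_of_gt hτ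
  · have h := (hderiv 0).continuousAt.tendsto
    simp only [zero_smul, add_zero, sub_self, zero_mul] at h
    exact h.mono_left nhdsWithin_le_nhds
  · have : Continuous fun τ : ℝ => 1 / 2 * τ ^ 2 := by fun_prop
    have h := this.tendsto 0
    norm_num at h
    exact h.mono_left nhdsWithin_le_nhds
  · have h := ((tendsto_const_nhds (x := w)).sub (tendsto_prox_slope hD w)).inner (𝕜 := ℝ)
      (tendsto_const_nhds (x := w))
    have h2 := h.const_mul (2 * c)
    rw [real_inner_comm w (w - D w)] at h2
    refine h2.congr' ?_
    filter_upwards [self_mem_nhdsWithin] with τ hτ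
    have hτ : τ ≠ 0 := ne_of_gt hτ
    rw [← inner_sub_left, ← smul_sub, inner_smul_left, conj_trivial, mul_div_assoc]
    congr 1
    rw [eq_div_iff hτ, mul_comm, ← real_inner_smul_left]
    congr 1
    rw [smul_sub, smul_inv_smul₀ hτ]
    abel

theorem norm_sub_add_smul_sq (x z u w : EuclideanSpace ℝ (Fin n)) (τ : ℝ) :
    ‖x + τ • u - (z + τ • w)‖ ^ 2 =
      ‖x - z‖ ^ 2 - 2 * τ * inner ℝ (z - x) (u - w) + τ ^ 2 * ‖w - u‖ ^ 2 := by
  have : x + τ • u - (z + τ • w) = (x - z) + τ • (u - w) := by module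
  rw [this, norm_add_sq_real, norm_smul, inner_smul_right, mul_pow, Real.norm_eq_abs, sq_abs,
    norm_sub_rev u w, ← neg_sub z x, inner_neg_left, norm_neg]
  ring

/-- `P z + τ u` is a competitor for the envelope at `z + τ w`; the terms linear in `τ` cancel. -/
theorem envelope_secondDiff_sub_le (hP : ∀ z, IsProxPoint φ c κ z (P z)) (hbot : ∀ x, φ x ≠ ⊥)
    (hκ : 0 ≤ κ) (u w : EuclideanSpace ℝ (Fin n)) {τ : ℝ} (hτ : 0 < τ) :
    (((envelope φ c P (z + τ • w) - envelope φ c P z -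
      τ * inner ℝ ((2 * c) • (z - P z)) w) / (1 / 2 * τ ^ 2) - 2 * c * ‖w - u‖ ^ 2 : ℝ) : EReal) ≤
      secondDiff φ (P z) ((2 * c) • (z - P z)) τ u := by
  refine coe_le_secondDiff hbot (hP z).1 hτ fun hu => ?_
  have h1 := envelope_le hP hκ (z + τ • w) hu
  rw [norm_sub_add_smul_sq] at h1
  rw [sub_mul, div_mul_cancel₀ _ (by positivity)]
  have h2 : envelope φ c P z = (φ (P z)).toReal + c * ‖P z - z‖ ^ 2 := rfl
  rw [h2]
  simp only [inner_smul_left, conj_trivial]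
  rw [inner_sub_right] at h1
  linarith

/-- The preceding inequality is an equality when `P z + τ u = P (z + τ w)`, which is what this
direction `u` achieves. -/
theorem secondDiff_prox_slope (hP : ∀ z, IsProxPoint φ c κ z (P z)) (hbot : ∀ x, φ x ≠ ⊥)
    (w : EuclideanSpace ℝ (Fin n)) {τ : ℝ} (hτ : 0 < τ) :
    secondDiff φ (P z) ((2 * c) • (z - P z)) τ (τ⁻¹ • (P (z + τ • w) - P z)) =
    (((envelope φ c P (z + τ • w) - envelope φ c P z -
      τ * inner ℝ ((2 * c) • (z - P z)) w) / (1 / 2 * τ ^ 2) -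
        2 * c * ‖w - τ⁻¹ • (P (z + τ • w) - P z)‖ ^ 2 : ℝ) : EReal) := by
  set u := τ⁻¹ • (P (z + τ • w) - P z) with hu
  have hxu : P z + τ • u = P (z + τ • w) := by
    rw [hu, smul_inv_smul₀ hτ.ne']
    abel
  rw [secondDiff_eq_coe hbot _ (hP z).1 (by rw [hxu]; exact (hP _).1), EReal.coe_eq_coe_iff,
    eq_sub_iff_add_eq, div_add' _ _ _ (by positivity)]
  congr 1
  have h1 : envelope φ c P (z + τ • w) =
    (φ (P z + τ • u)).toReal + c * ‖P z + τ • u - (z + τ • w)‖ ^ 2 := by rw [hxu]; rfl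
  have h2 : envelope φ c P z = (φ (P z)).toReal + c * ‖P z - z‖ ^ 2 := rfl
  rw [h1, h2, norm_sub_add_smul_sq, inner_sub_right]
  simp only [inner_smul_left, conj_trivial]
  ring

/-- Here `w` is a free parameter: it is matched to `u` for the exact value on the range of `D`, and
sent to infinity in the kernel of `D` off the range. -/
theorem coe_le_secondSubderiv_prox (hP : ∀ z, IsProxPoint φ c κ z (P z)) (hbot : ∀ x, φ x ≠ ⊥)
    (hc : 0 < c) (hκ : 0 < κ) (hD : HasFDerivAt P D z) (u w : EuclideanSpace ℝ (Fin n)) :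
    ((2 * c * (2 * inner ℝ w u - inner ℝ w (D w) - ‖u‖ ^ 2) : ℝ) : EReal) ≤
      secondSubderiv φ (P z) ((2 * c) • (z - P z)) u := by
  have hlim : Tendsto (fun p : ℝ × EuclideanSpace ℝ (Fin n) =>
      (((envelope φ c P (z + p.1 • w) - envelope φ c P z -
        p.1 * inner ℝ ((2 * c) • (z - P z)) w) / (1 / 2 * p.1 ^ 2) -
          2 * c * ‖w - p.2‖ ^ 2 : ℝ) : EReal)) (𝓝[>] 0 ×ˢ 𝓝 u)
      (𝓝 ((2 * c * inner ℝ w (w - D w) - 2 * c * ‖w - u‖ ^ 2 : ℝ) : EReal)) := by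
    rw [EReal.tendsto_coe]
    refine ((tendsto_envelope_secondDiff hP hc hκ hD w).comp tendsto_fst).sub ?_
    exact (((tendsto_const_nhds (x := w)).sub tendsto_snd).norm.pow 2).const_mul (2 * c)
  have hval : 2 * c * (2 * inner ℝ w u - inner ℝ w (D w) - ‖u‖ ^ 2) =
      2 * c * inner ℝ w (w - D w) - 2 * c * ‖w - u‖ ^ 2 := by
    rw [norm_sub_sq_real, inner_sub_right, real_inner_self_eq_norm_sq]
    ring
  rw [hval, ← hlim.liminf_eq]
  refine liminf_le_liminf ?_
  have hτ : ∀ᶠ p : ℝ × EuclideanSpace ℝ (Fin n) in 𝓝[>] 0 ×ˢ 𝓝 u, 0 < p.1 :=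
    tendsto_fst.eventually self_mem_nhdsWithin
  filter_upwards [hτ] with p hp
  exact envelope_secondDiff_sub_le hP hbot hκ.le p.2 w hp

theorem tendsto_secondDiff_prox_slope (hP : ∀ z, IsProxPoint φ c κ z (P z))
    (hbot : ∀ x, φ x ≠ ⊥) (hc : 0 < c) (hκ : 0 < κ) (hD : HasFDerivAt P D z)
    (w : EuclideanSpace ℝ (Fin n)) :
    Tendsto (fun τ : ℝ => secondDiff φ (P z) ((2 * c) • (z - P z)) τ
      (τ⁻¹ • (P (z + τ • w) - P z))) (𝓝[>] 0)
      (𝓝 ((2 * c * inner ℝ (D w) (w - D w) : ℝ) : EReal)) := by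
  have hval : 2 * c * inner ℝ (D w) (w - D w) =
      2 * c * inner ℝ w (w - D w) - 2 * c * ‖w - D w‖ ^ 2 := by
    rw [← real_inner_self_eq_norm_sq, ← mul_sub, ← inner_sub_left, sub_sub_cancel]
  have hlim := (tendsto_envelope_secondDiff hP hc hκ hD w).sub
    ((((tendsto_const_nhds (x := w)).sub (tendsto_prox_slope hD w)).norm.pow 2).const_mul (2 * c))
  rw [← hval] at hlim
  refine (EReal.tendsto_coe.2 hlim).congr' ?_
  filter_upwards [self_mem_nhdsWithin] with τ hτ
  exact (secondDiff_prox_slope hP hbot w hτ).symm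

theorem secondSubderiv_prox_apply (hP : ∀ z, IsProxPoint φ c κ z (P z))
    (hbot : ∀ x, φ x ≠ ⊥) (hc : 0 < c) (hκ : 0 < κ) (hD : HasFDerivAt P D z)
    (w : EuclideanSpace ℝ (Fin n)) :
    secondSubderiv φ (P z) ((2 * c) • (z - P z)) (D w) =
      ((2 * c * inner ℝ (D w) (w - D w) : ℝ) : EReal) := by
  refine le_antisymm ?_ ?_
  · have htend : Tendsto (fun τ : ℝ => (τ, τ⁻¹ • (P (z + τ • w) - P z))) (𝓝[>] 0)
        (𝓝[>] 0 ×ˢ 𝓝 (D w)) := tendsto_id.prodMk (tendsto_prox_slope hD w)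
    rw [← (tendsto_secondDiff_prox_slope hP hbot hc hκ hD w).liminf_eq]
    exact liminf_le_liminf_of_le (u := fun p : ℝ × EuclideanSpace ℝ (Fin n) =>
      secondDiff φ (P z) ((2 * c) • (z - P z)) p.1 p.2) htend
  · refine le_of_eq_of_le ?_ (coe_le_secondSubderiv_prox hP hbot hc hκ hD (D w) w)
    rw [EReal.coe_eq_coe_iff, inner_sub_right, real_inner_self_eq_norm_sq, real_inner_comm]
    ring

theorem secondSubderiv_prox_eq_top (hP : ∀ z, IsProxPoint φ c κ z (P z))
    (hbot : ∀ x, φ x ≠ ⊥) (hc : 0 < c) (hκ : 0 < κ) (hD : HasFDerivAt P D z)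
    {u : EuclideanSpace ℝ (Fin n)}
    (hu : u ∉ LinearMap.range (D : EuclideanSpace ℝ (Fin n) →ₗ[ℝ] EuclideanSpace ℝ (Fin n))) :
    secondSubderiv φ (P z) ((2 * c) • (z - P z)) u = ⊤ := by
  obtain ⟨k, hk, hku⟩ : ∃ k ∈ (LinearMap.range
      (D : EuclideanSpace ℝ (Fin n) →ₗ[ℝ] EuclideanSpace ℝ (Fin n)))ᗮ, inner ℝ k u ≠ 0 := by
    by_contra! h
    refine hu ?_
    rw [← Submodule.orthogonal_orthogonal (LinearMap.range _), Submodule.mem_orthogonal]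
    exact h
  have hDk : D k = 0 := by
    rw [← inner_self_eq_zero (𝕜 := ℝ), ← inner_fderiv_prox_comm hP hc hκ hD]
    exact (Submodule.mem_orthogonal _ _).1 hk _ ⟨D k, rfl⟩
  rw [EReal.eq_top_iff_forall_lt]
  intro b
  -- Since `D k = 0`, the bound is affine in the multiple of `k`; this multiple makes it equal to `b
  -- + 1`.
  have h := coe_le_secondSubderiv_prox hP hbot hc hκ hD u
    ((((b + 1) / (2 * c) + ‖u‖ ^ 2) / (2 * inner ℝ k u)) • k)
  refine lt_of_lt_of_le ?_ h
  rw [EReal.coe_lt_coe_iff, map_smul, hDk, smul_zero, inner_zero_right, inner_smul_left,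
    conj_trivial]
  have : 2 * c * (2 * (((b + 1) / (2 * c) + ‖u‖ ^ 2) / (2 * inner ℝ k u) * inner ℝ k u) - 0 -
      ‖u‖ ^ 2) = b + 1 := by
    field_simp
    ring
  rw [this]
  linarith

theorem twiceEpiDifferentiableAt_prox (hP : ∀ z, IsProxPoint φ c κ z (P z))
    (hbot : ∀ x, φ x ≠ ⊥) (hc : 0 < c) (hκ : 0 < κ) (hD : HasFDerivAt P D z) :
    TwiceEpiDifferentiableAt φ (P z) ((2 * c) • (z - P z)) := by
  intro u τ hτ0 hτ
  have hτ' : Tendsto τ atTop (𝓝[>] 0) :=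
    tendsto_nhdsWithin_iff.2 ⟨hτ, Eventually.of_forall hτ0⟩
  by_cases hu : u ∈ LinearMap.range
    (D : EuclideanSpace ℝ (Fin n) →ₗ[ℝ] EuclideanSpace ℝ (Fin n))
  · obtain ⟨w, rfl⟩ := hu
    refine ⟨fun k => (τ k)⁻¹ • (P (z + τ k • w) - P z), (tendsto_prox_slope hD w).comp hτ', ?_⟩
    have h := secondSubderiv_prox_apply hP hbot hc hκ hD w
    rw [ContinuousLinearMap.coe_coe, h]
    exact (tendsto_secondDiff_prox_slope hP hbot hc hκ hD w).comp hτ'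
  -- Where the lower limit is `∞`, any sequence tending to `u` is a recovery sequence.
  · refine ⟨fun _ => u, tendsto_const_nhds, ?_⟩
    have h := secondSubderiv_prox_eq_top hP hbot hc hκ hD hu
    rw [h, EReal.tendsto_nhds_top_iff_real]
    intro b
    have hev : ∀ᶠ p : ℝ × EuclideanSpace ℝ (Fin n) in 𝓝[>] 0 ×ˢ 𝓝 u,
        (b : EReal) < secondDiff φ (P z) ((2 * c) • (z - P z)) p.1 p.2 := by
      refine eventually_lt_of_lt_liminf ?_
      exact lt_of_lt_of_eq (EReal.coe_lt_top b) h.symm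
    exact (hτ'.prodMk (tendsto_const_nhds (x := u))).eventually hev

/-- The quadratic form `w ↦ a ⟪T w, w - T w⟫` of a symmetric operator `T` factors through `T`. -/
theorem exists_symm_quadForm_of_symmetric
    (T : EuclideanSpace ℝ (Fin n) →ₗ[ℝ] EuclideanSpace ℝ (Fin n)) (hT : T.IsSymmetric) (a : ℝ) :
    ∃ A : Matrix (Fin n) (Fin n) ℝ, A.IsSymm ∧
      ∀ w, quadForm A (T w) = a * inner ℝ (T w) (w - T w) := by
  obtain ⟨g, hg⟩ := T.rangeRestrict.exists_rightInverse_of_surjective T.range_rangeRestrict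
  -- `S` is a generalized inverse, `T S T = T`, so `⟪T w, S (T w)⟫ = ⟪T w, w⟫` by symmetry of `T`.
  -- Only the symmetric part of `S` matters to the form, whence `Q`.
  obtain ⟨S, hS⟩ := g.exists_extend
  have hTS : ∀ w, T (S (T w)) = T w := by
    intro w
    have h1 : S (T w) = g (T.rangeRestrict w) := by
      rw [← hS]
      rfl
    have h2 := LinearMap.congr_fun hg (T.rangeRestrict w)
    rw [h1]
    exact congrArg Subtype.val h2
  let Q : EuclideanSpace ℝ (Fin n) →ₗ[ℝ] EuclideanSpace ℝ (Fin n) :=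
    a • ((1 / 2 : ℝ) • (S + LinearMap.adjoint S) - LinearMap.id)
  have hQ : Q.IsSymmetric := by
    intro x y
    simp only [Q, LinearMap.smul_apply, LinearMap.sub_apply, LinearMap.add_apply,
      LinearMap.id_apply, inner_smul_left, inner_smul_right, inner_sub_left, inner_sub_right,
      inner_add_left, inner_add_right, LinearMap.adjoint_inner_left, LinearMap.adjoint_inner_right,
      conj_trivial]
    ring
  refine ⟨Matrix.toEuclideanLin.symm Q, ?_, fun w => ?_⟩
  · have h : (Matrix.toEuclideanLin.symm Q).IsHermitian := by
      rw [← Matrix.isSymmetric_toEuclideanLin_iff, LinearEquiv.apply_symm_apply]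
      exact hQ
    rwa [Matrix.IsHermitian, Matrix.conjTranspose_eq_transpose_of_trivial] at h
  · rw [quadForm, LinearEquiv.apply_symm_apply]
    have h1 : inner ℝ (T w) (S (T w)) = inner ℝ (T w) w := by
      rw [hT, hTS, hT]
    simp only [Q, LinearMap.smul_apply, LinearMap.sub_apply, LinearMap.add_apply,
      LinearMap.id_apply, inner_smul_right, inner_sub_right,
      inner_add_right, LinearMap.adjoint_inner_right]
    rw [real_inner_comm (T w) (S (T w)), h1]
    ring

theorem generalizedTwiceDifferentiableAt_prox (hP : ∀ z, IsProxPoint φ c κ z (P z))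
    (hbot : ∀ x, φ x ≠ ⊥) (hc : 0 < c) (hκ : 0 < κ) (hD : HasFDerivAt P D z) :
    GeneralizedTwiceDifferentiableAt φ (P z) ((2 * c) • (z - P z)) := by
  refine ⟨twiceEpiDifferentiableAt_prox hP hbot hc hκ hD, ?_⟩
  obtain ⟨A, hA, hAD⟩ := exists_symm_quadForm_of_symmetric
    (D : EuclideanSpace ℝ (Fin n) →ₗ[ℝ] EuclideanSpace ℝ (Fin n))
    (fun a b => inner_fderiv_prox_comm hP hc hκ hD a b) (2 * c)
  refine ⟨A, LinearMap.range (D : EuclideanSpace ℝ (Fin n) →ₗ[ℝ] EuclideanSpace ℝ (Fin n)), hA,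
    fun u => ?_⟩
  by_cases hu : u ∈ LinearMap.range
    (D : EuclideanSpace ℝ (Fin n) →ₗ[ℝ] EuclideanSpace ℝ (Fin n))
  · rw [indicatorFn, if_pos (SetLike.mem_coe.2 hu), add_zero]
    obtain ⟨w, rfl⟩ := hu
    rw [hAD]
    exact secondSubderiv_prox_apply hP hbot hc hκ hD w
  · rw [indicatorFn, if_neg (SetLike.mem_coe.not.2 hu), EReal.coe_add_top]
    exact secondSubderiv_prox_eq_top hP hbot hc hκ hD hu

/-- If the second subderivatives at points of generalized twice differentiability are nonnegative,
then so is the derivative of `z ↦ z - P z`. -/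
theorem inner_sub_fderiv_prox_nonneg (hP : ∀ z, IsProxPoint φ c κ z (P z))
    (hbot : ∀ x, φ x ≠ ⊥) (hc : 0 < c) (hκ : 0 < κ) (hD : HasFDerivAt P D z)
    (hφ : ∀ w x v : EuclideanSpace ℝ (Fin n), v ∈ subdifferential φ x →
      GeneralizedTwiceDifferentiableAt φ x v → 0 ≤ secondSubderiv φ x v w)
    (w : EuclideanSpace ℝ (Fin n)) : 0 ≤ inner ℝ (w - D w) w := by
  have h := hφ (D w) _ _ (prox_mem_subdifferential hP hbot hc.le hκ.le z)
    (generalizedTwiceDifferentiableAt_prox hP hbot hc hκ hD)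
  rw [secondSubderiv_prox_apply hP hbot hc hκ hD w] at h
  have h1 : 0 ≤ 2 * c * inner ℝ (D w) (w - D w) := by exact_mod_cast h
  have h2 : 0 ≤ inner ℝ (D w) (w - D w) := nonneg_of_mul_nonneg_right h1 (by positivity)
  have h3 : inner ℝ (w - D w) w = inner ℝ (w - D w) (w - D w) + inner ℝ (D w) (w - D w) := by
    rw [← inner_add_left, sub_add_cancel, real_inner_comm]
  rw [h3]
  exact add_nonneg real_inner_self_nonneg h2

end SecondOrder

/-! ### From an almost everywhere derivative condition to convexity -/

section Convexity

variable {n : ℕ} {φ : EuclideanSpace ℝ (Fin n) → EReal} {c κ s : ℝ}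
  {P : EuclideanSpace ℝ (Fin n) → EuclideanSpace ℝ (Fin n)}

open MeasureTheory in
/-- Almost every line with a given direction lies almost everywhere in a given conull set. -/
theorem ae_ae_line_mem {S : Set (EuclideanSpace ℝ (Fin n))} (hS : MeasurableSet S)
    (hae : ∀ᵐ z, z ∈ S) (d : EuclideanSpace ℝ (Fin n)) :
    ∀ᵐ h : EuclideanSpace ℝ (Fin n), ∀ᵐ t : ℝ, h + t • d ∈ S := by
  have hmeas : MeasurableSet {p : EuclideanSpace ℝ (Fin n) × ℝ | p.1 + p.2 • d ∈ S} := by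
    have hcont : Continuous fun p : EuclideanSpace ℝ (Fin n) × ℝ => p.1 + p.2 • d := by fun_prop
    exact hcont.measurable hS
  -- After the Fubini exchange, each fixed `t` only requires that a translate of a conull set is
  -- conull.
  rw [Measure.ae_ae_comm hmeas]
  refine Eventually.of_forall fun t => ?_
  exact (measurePreserving_add_right volume (t • d)).quasiMeasurePreserving.ae hae

/-- A Lipschitz map on `ℝⁿ` with almost everywhere positive semidefinite derivative is monotone. -/
theorem inner_sub_nonneg_of_fderiv_nonneg {K : NNReal}
    {G : EuclideanSpace ℝ (Fin n) → EuclideanSpace ℝ (Fin n)} (hG : LipschitzWith K G)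
    (hpos : ∀ z (D : EuclideanSpace ℝ (Fin n) →L[ℝ] EuclideanSpace ℝ (Fin n)),
      HasFDerivAt G D z → ∀ w, 0 ≤ inner ℝ (D w) w)
    (x y : EuclideanSpace ℝ (Fin n)) : 0 ≤ inner ℝ (G y - G x) (y - x) := by
  set d := y - x with hd
  have hae := ae_ae_line_mem (measurableSet_of_differentiableAt ℝ G)
    (hG.ae_differentiableAt (μ := MeasureTheory.volume)) d
  have hline : ∀ᵐ h : EuclideanSpace ℝ (Fin n), 0 ≤ inner ℝ (G (h + d) - G h) d := by
    filter_upwards [hae] with h hh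
    let g : ℝ → ℝ := fun t => inner ℝ (G (h + t • d)) d
    have hg : LipschitzWith (K * ‖d‖₊ * ‖d‖₊) g := by
      refine LipschitzWith.of_dist_le_mul fun t t' => ?_
      have h1 := hG.dist_le_mul (h + t • d) (h + t' • d)
      have h2 : dist (h + t • d) (h + t' • d) = ‖d‖ * dist t t' := by
        rw [dist_add_left, dist_eq_norm, ← sub_smul, norm_smul, ← dist_eq_norm, mul_comm]
      rw [h2, dist_eq_norm] at h1
      rw [Real.dist_eq, ← inner_sub_left]
      refine (abs_real_inner_le_norm _ _).trans ?_
      push_cast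
      calc _ ≤ (K * (‖d‖ * dist t t')) * ‖d‖ := by gcongr
        _ = _ := by ring
    -- On a good line the increment of `g` is the integral of its almost everywhere nonnegative
    -- derivative.
    have hint := (hg.lipschitzOnWith (s := Set.uIcc 0 1)).absolutelyContinuousOnInterval
      |>.integral_deriv_eq_sub
    have hnonneg : 0 ≤ ∫ t in (0 : ℝ)..1, deriv g t := by
      refine intervalIntegral.integral_nonneg_of_ae zero_le_one ?_
      filter_upwards [hh] with t ht
      have hdiff : HasFDerivAt G (fderiv ℝ G (h + t • d)) (h + t • d) :=
        DifferentiableAt.hasFDerivAt ht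
      have hl : HasDerivAt (fun τ : ℝ => h + τ • d) d t := by
        simpa using ((hasDerivAt_id t).smul_const d).const_add h
      have hgd := (hdiff.comp_hasDerivAt t hl).inner ℝ (hasDerivAt_const t d)
      have hval : deriv g t = inner ℝ (fderiv ℝ G (h + t • d) d) d := by
        have := hgd.deriv
        rw [inner_zero_right, zero_add] at this
        exact this
      change 0 ≤ deriv g t
      rw [hval]
      exact hpos _ _ hdiff d
    rw [hint] at hnonneg
    simpa [g, inner_sub_left] using hnonneg
  have hclosed : IsClosed {h : EuclideanSpace ℝ (Fin n) | 0 ≤ inner ℝ (G (h + d) - G h) d} := by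
    refine isClosed_le continuous_const ?_
    have := hG.continuous
    fun_prop
  -- Closed and conull, hence dense, the set of good base points is everything.
  have hmem : x ∈ {h : EuclideanSpace ℝ (Fin n) | 0 ≤ inner ℝ (G (h + d) - G h) d} := by
    rw [← hclosed.closure_eq]
    exact MeasureTheory.Measure.dense_of_ae hline x
  have hmem' : 0 ≤ inner ℝ (G (x + d) - G x) d := hmem
  rwa [hd, add_sub_cancel] at hmem'

theorem convexOn_of_hasFDerivAt_of_monotone {e : EuclideanSpace ℝ (Fin n) → ℝ}
    {G : EuclideanSpace ℝ (Fin n) → EuclideanSpace ℝ (Fin n)}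
    (he : ∀ z, HasFDerivAt e (innerSL ℝ (G z)) z)
    (hG : ∀ x y, 0 ≤ inner ℝ (G y - G x) (y - x)) : ConvexOn ℝ Set.univ e := by
  refine ⟨convex_univ, fun x _ y _ a b ha hb hab => ?_⟩
  have hderiv : ∀ t : ℝ, HasDerivAt (fun t : ℝ => e (x + t • (y - x)))
      (inner ℝ (G (x + t • (y - x))) (y - x)) t := by
    intro t
    have hl : HasDerivAt (fun τ : ℝ => x + τ • (y - x)) (y - x) t := by
      simpa using ((hasDerivAt_id t).smul_const (y - x)).const_add x
    exact (he _).comp_hasDerivAt t hl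
  have hmono : Monotone (deriv fun t : ℝ => e (x + t • (y - x))) := by
    intro t t' htt'
    rw [(hderiv t).deriv, (hderiv t').deriv]
    rcases htt'.eq_or_lt with rfl | hlt
    · rfl
    have h := hG (x + t • (y - x)) (x + t' • (y - x))
    rw [add_sub_add_left_eq_sub, ← sub_smul, inner_smul_right, inner_sub_left] at h
    have := nonneg_of_mul_nonneg_right h (sub_pos.2 hlt)
    linarith
  have hconv := hmono.convexOn_univ_of_deriv fun t => (hderiv t).differentiableAt
  have h := hconv.2 (Set.mem_univ (0 : ℝ)) (Set.mem_univ (1 : ℝ)) ha hb hab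
  simp only [smul_eq_mul, mul_zero, mul_one, zero_add, zero_smul, add_zero, one_smul,
    add_sub_cancel] at h
  have hxy : x + b • (y - x) = a • x + b • y := by
    obtain rfl : a = 1 - b := by linarith
    module
  rwa [hxy] at h

theorem convexOn_envelope (hP : ∀ z, IsProxPoint φ c κ z (P z))
    (hbot : ∀ x, φ x ≠ ⊥) (hc : 0 < c) (hκ : 0 < κ)
    (hφ : ∀ w x v : EuclideanSpace ℝ (Fin n), v ∈ subdifferential φ x →
      GeneralizedTwiceDifferentiableAt φ x v → 0 ≤ secondSubderiv φ x v w) :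
    ConvexOn ℝ Set.univ (envelope φ c P) := by
  refine convexOn_of_hasFDerivAt_of_monotone (hasFDerivAt_envelope hP hc.le hκ) fun x y => ?_
  have h := inner_sub_nonneg_of_fderiv_nonneg (G := fun z => z - P z)
    (LipschitzWith.id.sub (lipschitzWith_prox hP hc.le hκ)) (fun z D hD w => ?_) x y
  · rw [← smul_sub, inner_smul_left, conj_trivial]
    positivity
  · have hPD : HasFDerivAt P (ContinuousLinearMap.id ℝ _ - D) z := by
      have := (hasFDerivAt_id z).sub hD
      simpa [Function.comp_def, Pi.sub_def] using this
    have h2 := inner_sub_fderiv_prox_nonneg hP hbot hc hκ hPD hφ w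
    simpa using h2

/-- If convexity failed at some point, a real `b` would fit strictly between the chord and `φ`
there. For large `c` the convex envelope is at least `b` at that point but at most `φ` at the
endpoints. -/
theorem IsSConvex.isConvex_of_secondSubderiv_nonneg (hs : IsSConvex s φ) (hs0 : s ≤ 0)
    (hproper : IsProper φ) (hlsc : LowerSemicontinuous φ)
    (hφ : ∀ w x v : EuclideanSpace ℝ (Fin n), v ∈ subdifferential φ x →
      GeneralizedTwiceDifferentiableAt φ x v → 0 ≤ secondSubderiv φ x v w) : IsConvex φ := by
  have hbot := hproper.1
  intro x y t h0 h1
  have hzero : (0 / 2 * t * (1 - t) * ‖x - y‖ ^ 2 : ℝ) = 0 := by ring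
  rw [hzero, EReal.coe_zero, sub_zero]
  have h1t : 0 < 1 - t := by linarith
  -- In `EReal`, `⊤ + ⊥ = ⊥`, so an infinite endpoint value settles the claim only once the other
  -- summand is known not to be `⊥`.
  have hmulbot : ∀ (r : ℝ) (z : EuclideanSpace ℝ (Fin n)), 0 < r → (r : EReal) * φ z ≠ ⊥ := by
    intro r z hr
    by_cases hz : φ z = ⊤
    · rw [hz, EReal.coe_mul_top_of_pos hr]
      exact top_ne_bot
    · rw [← EReal.coe_toReal hz (hbot z), ← EReal.coe_mul]
      exact EReal.coe_ne_bot _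
  by_cases hx : φ x = ⊤
  · rw [hx, EReal.coe_mul_top_of_pos h1t, EReal.top_add_of_ne_bot (hmulbot t y h0)]
    exact le_top
  by_cases hy : φ y = ⊤
  · rw [hy, EReal.coe_mul_top_of_pos h0, EReal.add_top_of_ne_bot (hmulbot (1 - t) x h1t)]
    exact le_top
  rw [← EReal.coe_toReal hx (hbot x), ← EReal.coe_toReal hy (hbot y), ← EReal.coe_mul,
    ← EReal.coe_mul, ← EReal.coe_add]
  by_contra! hlt
  obtain ⟨b, hab, hb⟩ := EReal.lt_iff_exists_real_btwn.1 hlt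
  rw [EReal.coe_lt_coe_iff] at hab
  obtain ⟨c₀, hc₀⟩ := hs.exists_penalty_le hs0 hproper hlsc hb
  -- The second entry forces `c + s / 2 ≥ 1`.
  set c := max c₀ (1 - s / 2) with hc
  have hκ : 0 < c + s / 2 := by
    have := le_max_right c₀ (1 - s / 2)
    linarith
  have hcpos : 0 < c := by linarith
  choose P hP using exists_isProxPoint hs hs0 hproper hlsc hκ
  have hconv := (convexOn_envelope hP hbot hcpos hκ hφ).2 (Set.mem_univ x) (Set.mem_univ y)
    h1t.le h0.le (sub_add_cancel 1 t)
  have hm : b ≤ envelope φ c P ((1 - t) • x + t • y) :=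
    hc₀ c (le_max_left _ _) _ (hP _).1
  have hex := envelope_le hP hκ.le x hx
  have hey := envelope_le hP hκ.le y hy
  simp only [sub_self, norm_zero, ne_eq, OfNat.ofNat_ne_zero, not_false_eq_true, zero_pow,
    mul_zero, add_zero, smul_eq_mul] at hex hey hconv
  have h3 := mul_le_mul_of_nonneg_left hex h1t.le
  have h4 := mul_le_mul_of_nonneg_left hey h0.le
  linarith

end Convexity

end VarAnalysis

theorem mainTheorem2 {n : ℕ} (φ : EuclideanSpace ℝ (Fin n) → EReal)
    (hproper : VarAnalysis.IsProper φ) (hlsc : LowerSemicontinuous φ)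
    (hweak : VarAnalysis.IsWeaklyConvex φ) :
    List.TFAE [
      VarAnalysis.IsConvex φ,
      ∀ w x v : EuclideanSpace ℝ (Fin n), v ∈ VarAnalysis.subdifferential φ x →
        0 ≤ VarAnalysis.secondSubderiv φ x v w,
      ∀ w x v : EuclideanSpace ℝ (Fin n), v ∈ VarAnalysis.subdifferential φ x →
        VarAnalysis.TwiceEpiDifferentiableAt φ x v →
        0 ≤ VarAnalysis.secondSubderiv φ x v w,
      ∀ w x v : EuclideanSpace ℝ (Fin n), v ∈ VarAnalysis.subdifferential φ x →
        VarAnalysis.GeneralizedTwiceDifferentiableAt φ x v →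
        0 ≤ VarAnalysis.secondSubderiv φ x v w] := by
  tfae_have 1 → 2 := fun hc w x v hv => hc.secondSubderiv_nonneg hproper.1 hv w
  tfae_have 2 → 3 := fun h w x v hv _ => h w x v hv
  tfae_have 3 → 4 := fun h w x v hv hg => h w x v hv hg.1
  tfae_have 4 → 1 := fun h => by
    obtain ⟨s, hs0, hs⟩ := hweak
    exact hs.isConvex_of_secondSubderiv_nonneg hs0.le hproper hlsc h
  tfae_finish
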